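/- **Setting.** Let $K\ge 2$ designs and $D$ input components be given. The input distribution is a mixture $F^c=\sum_{j=1}^D w^c_jF_j$ of known probability distributions $F_j$ with densities $f_j$ (with respect to a common $\sigma$-finite measure) and unknown weights $w^c_j>0$, $\sum_jw^c_j=1$. The weights are identifiable: the Hellinger distance between $\sum_jw_jF_j$ and $F^c$ is nonzero for every $w\ne w^c$ in the simplex. The input data $\xi_1,\xi_2,\dots$ are i.i.d. with law $F^c$. For each design $i$ and component $j$, the simulation outputs $X_{i,j}^{(1)},X_{i,j}^{(2)},\dots$ are draws of the performance $X_i(\zeta)$ with $\zeta\sim F_j$; they have law $N(\mu_{i,j},\sigma_{i,j}^2)$ with $\sigma_{i,j}>0$, and all outputs are independent over $i$, $j$ and the replication index. The designs have pairwise distinct expected performances $\mu_i=\mathbb E_{F^c}[X_i(\zeta)]=\sum_jw^c_j\mu_{i,j}$, and $b=\arg\max_i\mu_i$. The data batch sizes $m(t)$ and simulation budgets $n(t)$, $t\ge1$, are given nonnegative integers with $\sum_tm(t)=\sum_tn(t)=\infty$. For a design $b'$, weights $w$, means $(m_i)$ and standard deviations $(s_{i,j})$, the *approximate optimality conditions*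 on an allocation $\alpha_{i,j}\ge0$, $\sum_{i,j}\alpha_{i,j}=1$, are $$\frac{\alpha_{i,j}}{\alpha_{i',j'}}=\frac{w_js_{i,j}\sum_ks_{i,k}w_k/(m_{b'}-m_i)^2}{w_{j'}s_{i',j'}\sum_ks_{i',k}w_k/(m_{b'}-m_{i'})^2}\quad(i,i'\ne b',\ 1\le j,j'\le D),$$ $$\Big(\frac{\alpha_{b',j}}{s_{b',j}}\Big)^2=\sum_{i\ne b'}\Big(\frac{\alpha_{i,j}}{s_{i,j}}\Big)^2\quad(1\le j\le D).$$ **Procedure IU-OCBA-approx** (with no bound on the total budget). Collect $n_0\ge2$ outputs of each pair $(i,j)$; put $\ell=0$ and $N^{(0)}_{i,j}=n_0$. In stage $t=1,2,\dots$ observe $m(t)$ new input data and let $\hat w^{(t)}$ be a maximum likelihood estimate of the weights, over the simplex, from the $m(1)+\dots+m(t)$ data seen so far. Then repeat $n(t)$ times: let $\hat\mu^{(\ell)}_{i,j},\hat\sigma^{(\ell)}_{i,j}$ be the sample mean and the sample standard deviation (denominator $N^{(\ell)}_{i,j}-1$) of the $N^{(\ell)}_{i,j}$ outputs of $(i,j)$,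 let $\hat\mu_i^{(\ell)}=\sum_j\hat w^{(t)}_j\hat\mu^{(\ell)}_{i,j}$ and $\hat b^{(\ell)}\in\arg\max_i\hat\mu^{(\ell)}_i$, let $\hat\alpha^{(\ell)}$ solve the approximate optimality conditions for $\hat b^{(\ell)},\hat w^{(t)},\hat\mu^{(\ell)}_i,\hat\sigma^{(\ell)}_{i,j}$ (it is arbitrary if there is no solution), simulate once a pair $(I,J)$ that maximizes $\hat\alpha^{(\ell)}_{i,j}(1+N^{(\ell)})-N^{(\ell)}_{i,j}$, where $N^{(\ell)}=\sum_{i,j}N^{(\ell)}_{i,j}$, increase its count by one, and increase $\ell$ by one. At the end of stage $t$ select a design that maximizes $\hat\mu_i^{(\ell)}=\sum_j\hat w^{(t)}_j\hat\mu^{(\ell)}_{i,j}$. Ties in every $\arg\max$ are broken arbitrarily. **Theorem.** For IU-OCBA-approx: 1. (Consistency) Almost surely, the design selected at the end of stage $t$ is $b$ for all sufficiently large $t$. 2. (Asymptotic optimality) There is exactly one allocation $\alpha^*$ that satisfies the approximate optimality conditions for the true parameters $b,w^c,\mu_i,\sigma_{i,j}$, and almost surely $\alpha_{i,j}^{(\ell)}=N^{(\ell)}_{i,j}/N^{(\ell)}\to\alpha^*_{i,j}$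 as $\ell\to\infty$, for all $1\le i\le K$, $1\le j\le D$. -/

import Mathlib

open MeasureTheory ProbabilityTheory Filter Topology
open scoped NNReal ENNReal

namespace IUOCBA

noncomputable section

/-! ### The input model -/

/-- The mixture `F^w = ∑ j, w j • F j` of the components `F j` with weights `w j`. -/
def mixture {Ξ : Type*} [MeasurableSpace Ξ] {D : ℕ} (F : Fin D → Measure Ξ) (w : Fin D → ℝ) :
    Measure Ξ :=
  ∑ j, ENNReal.ofReal (w j) • F j

/-- The Hellinger distance `(1 / √2) ‖√p - √q‖₂`, where `p` and `q` are the densities of `P` and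
`Q` with respect to a dominating measure. The value does not depend on the dominating measure, and
`P + Q` is one. -/
def hellinger {Ξ : Type*} [MeasurableSpace Ξ] (P Q : Measure Ξ) : ℝ :=
  (1 / √2) * √(∫ x, (√(P.rnDeriv (P + Q) x).toReal - √(Q.rnDeriv (P + Q) x).toReal) ^ 2 ∂(P + Q))

/-- Identifiability of the weights `wc`: no other weight vector gives the same mixture. -/
def Identifiable {Ξ : Type*} [MeasurableSpace Ξ] {D : ℕ} (F : Fin D → Measure Ξ)
    (wc : Fin D → ℝ) : Prop :=
  ∀ w ∈ stdSimplex ℝ (Fin D), w ≠ wc → hellinger (mixture F w) (mixture F wc) ≠ 0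

/-- The likelihood of the weights `w` given the first `M` input data, where `f j` is the density of
the `j`-th component. -/
def likelihood {Ξ : Type*} {D : ℕ} (f : Fin D → Ξ → ℝ≥0) (ξ : ℕ → Ξ) (M : ℕ)
    (w : Fin D → ℝ) : ℝ :=
  ∏ s ∈ Finset.range M, ∑ j, w j * (f j (ξ s) : ℝ)

/-- `w` is a maximum likelihood estimate of the weights given the first `M` input data. -/
def IsMLE {Ξ : Type*} {D : ℕ} (f : Fin D → Ξ → ℝ≥0) (ξ : ℕ → Ξ) (M : ℕ) (w : Fin D → ℝ) : Prop :=
  w ∈ stdSimplex ℝ (Fin D) ∧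
    ∀ w' ∈ stdSimplex ℝ (Fin D), likelihood f ξ M w' ≤ likelihood f ξ M w

/-- The expected performance `E_G[X_i(ζ)]` of a design under the input distribution `G`, where
`perf` gives the law of the random performance `X_i(ζ)` given the input `ζ`. -/
def expectedPerf {Ξ : Type*} [MeasurableSpace Ξ] (perf : Kernel Ξ ℝ) (G : Measure Ξ) : ℝ :=
  ∫ x, x ∂(G.bind perf)

/-! ### Stages -/

/-- The total `∑_{τ = 1}^t a τ` over the stages `1, …, t`. -/
def cumulative (a : ℕ → ℕ) (t : ℕ) : ℕ := ∑ τ ∈ Finset.Icc 1 t, a τ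

/-- The stage in which the `ℓ`-th simulation is run (`ℓ ≥ 1`), for the stage-wise budgets `n`: the
largest stage `t` such that fewer than `ℓ` simulations are run before stage `t`. -/
def stageOf (n : ℕ → ℕ) (ℓ : ℕ) : ℕ := sSup {t | 1 ≤ t ∧ cumulative n (t - 1) < ℓ}

/-! ### Estimates -/

/-- The mean of the first `N` terms of `x`. -/
def sampleMean (x : ℕ → ℝ) (N : ℕ) : ℝ := (∑ s ∈ Finset.range N, x s) / N

/-- The standard deviation (with denominator `N - 1`) of the first `N` terms of `x`. -/
def sampleStd (x : ℕ → ℝ) (N : ℕ) : ℝ :=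
  √((∑ s ∈ Finset.range N, (x s - sampleMean x N) ^ 2) / ((N : ℝ) - 1))

/-- The estimated performance of design `i` when the weights are estimated by `w` and `N i j`
outputs of each design-input pair are available; `x i j` is the sequence of outputs of `(i, j)`. -/
def estPerf {K D : ℕ} (x : Fin K → Fin D → ℕ → ℝ) (N : Fin K → Fin D → ℕ) (w : Fin D → ℝ)
    (i : Fin K) : ℝ :=
  ∑ j, w j * sampleMean (x i j) (N i j)

/-- The estimated standard deviations of the outputs of the design-input pairs. -/
def estStd {K D : ℕ} (x : Fin K → Fin D → ℕ → ℝ) (N : Fin K → Fin D → ℕ)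
    (i : Fin K) (j : Fin D) : ℝ :=
  sampleStd (x i j) (N i j)

/-! ### The allocation and the procedure -/

/-- `a` is an allocation (nonnegative, of total mass one) that satisfies the approximate optimality
conditions for the best design `b`, input weights `w`, expected performances `m` and standard
deviations `s`. -/
structure ApproxOptimal {K D : ℕ} (b : Fin K) (w : Fin D → ℝ) (m : Fin K → ℝ)
    (s : Fin K → Fin D → ℝ) (a : Fin K → Fin D → ℝ) : Prop where
  nonneg : ∀ i j, 0 ≤ a i j
  sum_eq_one : ∑ i, ∑ j, a i j = 1
  local_balance : ∀ i i', i ≠ b → i' ≠ b → ∀ j j',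
    a i j / a i' j' =
      (w j * s i j * (∑ k, s i k * w k) / (m b - m i) ^ 2) /
        (w j' * s i' j' * (∑ k, s i' k * w k) / (m b - m i') ^ 2)
  total_balance : ∀ j, (a b j / s b j) ^ 2 = ∑ i ∈ Finset.univ.erase b, (a i j / s i j) ^ 2

/-- The number `N_{i,j}^{(ℓ)}` of outputs of each design-input pair after `n₀` initial outputs of
every pair and `ℓ` further simulations, of the pairs `pair 0, …, pair (ℓ - 1)`. -/
def count {K D : ℕ} (n₀ : ℕ) (pair : ℕ → Fin K × Fin D) : ℕ → Fin K → Fin D → ℕ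
  | 0 => fun _ _ => n₀
  | ℓ + 1 => fun i j => count n₀ pair ℓ i j + if pair ℓ = (i, j) then 1 else 0

/-- The total number `N^{(ℓ)}` of outputs. -/
def totalCount {K D : ℕ} (n₀ : ℕ) (pair : ℕ → Fin K × Fin D) (ℓ : ℕ) : ℕ :=
  ∑ i, ∑ j, count n₀ pair ℓ i j

/-- A run, without a bound on the total budget, of the procedure IU-OCBA-approx on one sample path:
`ξ` are the input data and `x i j` the successive simulation outputs of the pair `(i, j)`. The
choices made by the procedure are the weight estimates `wHat t` (stages `t ≥ 1`), the current best
design `bHat ℓ`, the target allocation `aHat ℓ` and the simulated pair `pair ℓ` of the iteration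
that starts with `ℓ` simulations done, and the design `out t` selected at the end of stage `t`.
Every `arg max` is an arbitrary maximizer. The iteration that starts with `ℓ` simulations done runs
the simulation number `ℓ + 1`, in the stage `stageOf n (ℓ + 1)`. -/
structure IsRun {Ξ : Type*} {K D : ℕ} (f : Fin D → Ξ → ℝ≥0) (n₀ : ℕ) (m n : ℕ → ℕ)
    (ξ : ℕ → Ξ) (x : Fin K → Fin D → ℕ → ℝ)
    (wHat : ℕ → Fin D → ℝ) (bHat : ℕ → Fin K) (aHat : ℕ → Fin K → Fin D → ℝ)
    (pair : ℕ → Fin K × Fin D) (out : ℕ → Fin K) : Prop where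
  /-- In stage `t` the weights are estimated from the input data of the stages `1, …, t`. -/
  mle : ∀ t, 1 ≤ t → IsMLE f ξ (cumulative m t) (wHat t)
  /-- The current best design. -/
  best : ∀ ℓ i,
    estPerf x (count n₀ pair ℓ) (wHat (stageOf n (ℓ + 1))) i ≤
      estPerf x (count n₀ pair ℓ) (wHat (stageOf n (ℓ + 1))) (bHat ℓ)
  /-- The target allocation solves the approximate optimality conditions for the current estimates.
  Nothing is required of it in the degenerate case where these have no solution. -/
  target : ∀ ℓ,
    (∃ a, ApproxOptimal (bHat ℓ) (wHat (stageOf n (ℓ + 1)))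
      (estPerf x (count n₀ pair ℓ) (wHat (stageOf n (ℓ + 1)))) (estStd x (count n₀ pair ℓ)) a) →
    ApproxOptimal (bHat ℓ) (wHat (stageOf n (ℓ + 1)))
      (estPerf x (count n₀ pair ℓ) (wHat (stageOf n (ℓ + 1)))) (estStd x (count n₀ pair ℓ)) (aHat ℓ)
  /-- The simulated pair maximizes `aHat ℓ i j * (1 + N^{(ℓ)}) - N_{i,j}^{(ℓ)}`. -/
  choice : ∀ ℓ i j,
    aHat ℓ i j * (1 + (totalCount n₀ pair ℓ : ℝ)) - (count n₀ pair ℓ i j : ℝ) ≤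
      aHat ℓ (pair ℓ).1 (pair ℓ).2 * (1 + (totalCount n₀ pair ℓ : ℝ)) -
        (count n₀ pair ℓ (pair ℓ).1 (pair ℓ).2 : ℝ)
  /-- The design selected when the simulations of stage `t` are done. -/
  output : ∀ t, 1 ≤ t → ∀ i,
    estPerf x (count n₀ pair (cumulative n t)) (wHat t) i ≤
      estPerf x (count n₀ pair (cumulative n t)) (wHat t) (out t)

end

end IUOCBA

/-! The difficulty is circular: the estimates are consistent only if every pair is simulated
infinitely often, and the rule deciding what is simulated depends on the estimates. The way out is
to argue on a fixed sample path and allow wrong limits. Each count is nondecreasing, so it either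
stabilizes or diverges (`exists_eventually_count_eq_or_tendsto`); in both cases the sample means and
standard deviations converge, possibly to frozen values. Since the outputs have no atoms and there
are only countably many patterns of frozen counts, almost surely the limiting performances are
pairwise distinct (`ae_perf_ne`) and the limiting standard deviations are positive. Hence the
current best design is eventually constant, and the targets converge to the solution of the
optimality conditions for the limiting parameters, by its uniqueness and continuity
(`ApproxOptimal.eq_optAlloc`, `tendsto_optAlloc`). Choosing the largest deficit makes the empirical
proportions follow the targets (`tendsto_count_div_totalCount`). All entries of the limit are
positive, so no count can stabilize. The limiting parameters are therefore the true ones, which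
gives both claims (`IsRun.eventually_out_eq_and_tendsto`). The weights are treated separately by a
Wald argument with square roots of likelihood ratios (`ae_tendsto_of_isMLE`). Positivity of the true
weights bounds these ratios, and identifiability makes the mean of the square root less than 1 at
any wrong weight vector. The exceptional null set does not depend on the choice of maximizers, so no
measurability of the estimates is needed. -/

namespace IUOCBA

/-! ### The solution of the approximate optimality conditions -/

/-- The solution of the approximate optimality conditions, up to normalization. -/
noncomputable def optRatio {K D : ℕ} (b : Fin K) (w : Fin D → ℝ) (m : Fin K → ℝ)
    (s : Fin K → Fin D → ℝ) (i : Fin K) (j : Fin D) : ℝ :=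
  if i = b then
    s b j * √(∑ i' ∈ Finset.univ.erase b,
      (w j * s i' j * (∑ k, s i' k * w k) / (m b - m i') ^ 2 / s i' j) ^ 2)
  else w j * s i j * (∑ k, s i k * w k) / (m b - m i) ^ 2

/-- The solution of the approximate optimality conditions. -/
noncomputable def optAlloc {K D : ℕ} (b : Fin K) (w : Fin D → ℝ) (m : Fin K → ℝ)
    (s : Fin K → Fin D → ℝ) (i : Fin K) (j : Fin D) : ℝ :=
  optRatio b w m s i j / ∑ i', ∑ j', optRatio b w m s i' j'

section Solution

variable {K D : ℕ} {b : Fin K} {w : Fin D → ℝ} {m : Fin K → ℝ} {s : Fin K → Fin D → ℝ}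

lemma optRatio_of_ne {i : Fin K} (hi : i ≠ b) (j : Fin D) :
    optRatio b w m s i j = w j * s i j * (∑ k, s i k * w k) / (m b - m i) ^ 2 := by
  simp [optRatio, hi]

/-- Writes the entry of `b` through the other entries, so that total balance, positivity and
continuity at `b` are inherited from them. -/
lemma optRatio_best (j : Fin D) :
    optRatio b w m s b j =
      s b j * √(∑ i ∈ Finset.univ.erase b, (optRatio b w m s i j / s i j) ^ 2) := by
  rw [optRatio, if_pos rfl]
  congr 2
  refine Finset.sum_congr rfl fun i hi => ?_
  rw [optRatio_of_ne (Finset.ne_of_mem_erase hi)]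

variable (hw : ∀ j, 0 < w j) (hs : ∀ i j, 0 < s i j) (hm : ∀ i, i ≠ b → m i ≠ m b)
include hw hs hm

lemma optRatio_pos_of_ne {i : Fin K} (hi : i ≠ b) (j : Fin D) : 0 < optRatio b w m s i j := by
  rw [optRatio_of_ne hi]
  have h1 : m b - m i ≠ 0 := sub_ne_zero.2 (hm i hi).symm
  have h2 : 0 < ∑ k, s i k * w k :=
    Finset.sum_pos (fun k _ => mul_pos (hs i k) (hw k)) ⟨j, Finset.mem_univ j⟩
  have := hw j
  have := hs i j
  positivity

variable {i₀ : Fin K} (hi₀ : i₀ ≠ b)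
include hi₀

/-- The second design `i₀` keeps the sum under the square root from being empty. -/
lemma optRatio_pos (i : Fin K) (j : Fin D) : 0 < optRatio b w m s i j := by
  by_cases hi : i = b
  · subst hi
    rw [optRatio_best]
    refine mul_pos (hs i j) (Real.sqrt_pos.2 (Finset.sum_pos (fun k hk => ?_)
      ⟨i₀, Finset.mem_erase.2 ⟨hi₀, Finset.mem_univ _⟩⟩))
    exact pow_pos (div_pos (optRatio_pos_of_ne hw hs hm (Finset.ne_of_mem_erase hk) j)
      (hs k j)) 2
  · exact optRatio_pos_of_ne hw hs hm hi j

lemma sum_optRatio_pos (j₀ : Fin D) : 0 < ∑ i, ∑ j, optRatio b w m s i j :=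
  Finset.sum_pos (fun i _ => Finset.sum_pos (fun j _ => optRatio_pos hw hs hm hi₀ i j)
    ⟨j₀, Finset.mem_univ _⟩) ⟨b, Finset.mem_univ _⟩

lemma optAlloc_pos (i : Fin K) (j : Fin D) : 0 < optAlloc b w m s i j :=
  div_pos (optRatio_pos hw hs hm hi₀ i j) (sum_optRatio_pos hw hs hm hi₀ j)

/-- Both balance conditions are homogeneous in the allocation, so normalizing preserves them. -/
lemma approxOptimal_optAlloc (j₀ : Fin D) : ApproxOptimal b w m s (optAlloc b w m s) where
  nonneg i j := (optAlloc_pos hw hs hm hi₀ i j).le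
  sum_eq_one := by
    simp only [optAlloc, ← Finset.sum_div]
    exact div_self (sum_optRatio_pos hw hs hm hi₀ j₀).ne'
  local_balance i i' hi hi' j j' := by
    rw [optAlloc, optAlloc, div_div_div_cancel_right₀ (sum_optRatio_pos hw hs hm hi₀ j₀).ne',
      optRatio_of_ne hi, optRatio_of_ne hi']
  total_balance j := by
    have hT := (sum_optRatio_pos hw hs hm hi₀ j₀).ne'
    simp only [optAlloc]
    rw [optRatio_best, mul_div_assoc, mul_div_cancel_left₀ _ (hs b j).ne', div_pow,
      Real.sq_sqrt (Finset.sum_nonneg fun _ _ => sq_nonneg _), Finset.sum_div]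
    refine Finset.sum_congr rfl fun i _ => ?_
    rw [div_right_comm, div_pow _ (∑ i', ∑ j', optRatio b w m s i' j')]

/-- Local balance makes `a` proportional to `optRatio` away from `b`; total balance and
nonnegativity force the same factor `c` at `b`; the unit mass determines `c`. -/
lemma ApproxOptimal.eq_optAlloc (j₀ : Fin D) {a : Fin K → Fin D → ℝ}
    (ha : ApproxOptimal b w m s a) : a = optAlloc b w m s := by
  have hpos := optRatio_pos hw hs hm hi₀
  obtain ⟨c, hc⟩ : ∃ c, c = a i₀ j₀ / optRatio b w m s i₀ j₀ := ⟨_, rfl⟩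
  have hne : ∀ i, i ≠ b → ∀ j, a i j = c * optRatio b w m s i j := by
    intro i hi j
    have h := ha.local_balance i i₀ hi hi₀ j j₀
    rw [← optRatio_of_ne hi, ← optRatio_of_ne hi₀] at h
    -- Division by zero yields 0, while the prescribed ratio is positive.
    have h0 : a i₀ j₀ ≠ 0 := by
      intro h0
      rw [h0, div_zero] at h
      exact (div_pos (hpos i j) (hpos i₀ j₀)).ne h
    rw [div_eq_div_iff h0 (hpos i₀ j₀).ne'] at h
    rw [hc, div_mul_eq_mul_div, eq_div_iff (hpos i₀ j₀).ne', h, mul_comm]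
  have hc0 : 0 ≤ c := hc ▸ div_nonneg (ha.nonneg _ _) (hpos _ _).le
  have hall : ∀ i j, a i j = c * optRatio b w m s i j := by
    intro i j
    by_cases hi : i = b
    · subst hi
      have h := ha.total_balance j
      have h2 : ∑ k ∈ Finset.univ.erase i, (a k j / s k j) ^ 2 =
          c ^ 2 * ∑ k ∈ Finset.univ.erase i, (optRatio i w m s k j / s k j) ^ 2 := by
        rw [Finset.mul_sum]
        refine Finset.sum_congr rfl fun k hk => ?_
        rw [hne k (Finset.ne_of_mem_erase hk), mul_div_assoc, mul_pow]
      have h3 : a i j / s i j = √(∑ k ∈ Finset.univ.erase i, (a k j / s k j) ^ 2) := by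
        rw [← h, Real.sqrt_sq (div_nonneg (ha.nonneg _ _) (hs i j).le)]
      rw [h2, Real.sqrt_mul (sq_nonneg _), Real.sqrt_sq hc0, div_eq_iff (hs i j).ne'] at h3
      rw [h3, optRatio_best]
      ring
    · exact hne i hi j
  have hsum := ha.sum_eq_one
  simp only [hall, ← Finset.mul_sum] at hsum
  ext i j
  rw [hall, optAlloc, eq_one_div_of_mul_eq_one_left hsum]
  ring

lemma tendsto_optAlloc {ι : Type*} {l : Filter ι} {w' : ι → Fin D → ℝ} {m' : ι → Fin K → ℝ}
    {s' : ι → Fin K → Fin D → ℝ} (hw' : ∀ j, Tendsto (fun t => w' t j) l (𝓝 (w j)))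
    (hm' : ∀ i, Tendsto (fun t => m' t i) l (𝓝 (m i)))
    (hs' : ∀ i j, Tendsto (fun t => s' t i j) l (𝓝 (s i j))) (i : Fin K) (j : Fin D) :
    Tendsto (fun t => optAlloc b (w' t) (m' t) (s' t) i j) l (𝓝 (optAlloc b w m s i j)) := by
  have hne : ∀ i, i ≠ b → ∀ j, Tendsto (fun t => optRatio b (w' t) (m' t) (s' t) i j) l
      (𝓝 (optRatio b w m s i j)) := by
    intro i hi j
    simp only [optRatio_of_ne hi]
    refine Tendsto.div (((hw' j).mul (hs' i j)).mul
      (tendsto_finsetSum _ fun k _ => (hs' i k).mul (hw' k)))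
      (((hm' b).sub (hm' i)).pow 2) (pow_ne_zero 2 (sub_ne_zero.2 (hm i hi).symm))
  have hall : ∀ i j, Tendsto (fun t => optRatio b (w' t) (m' t) (s' t) i j) l
      (𝓝 (optRatio b w m s i j)) := by
    intro i j
    by_cases hi : i = b
    · subst hi
      simp only [optRatio_best]
      refine (hs' i j).mul ((tendsto_finsetSum _ fun k hk => ?_).sqrt)
      exact ((hne k (Finset.ne_of_mem_erase hk) j).div (hs' k j) (hs k j).ne').pow 2
    · exact hne i hi j
  exact (hall i j).div (tendsto_finsetSum _ fun i _ => tendsto_finsetSum _ fun j _ => hall i j)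
    (sum_optRatio_pos hw hs hm hi₀ j).ne'

end Solution

/-! ### Counts -/

section Count

variable {K D : ℕ} (n₀ : ℕ) (pair : ℕ → Fin K × Fin D)

lemma count_mono (i : Fin K) (j : Fin D) : Monotone fun ℓ => count n₀ pair ℓ i j :=
  monotone_nat_of_le_succ fun ℓ => by simp [count]

lemma le_count (ℓ : ℕ) (i : Fin K) (j : Fin D) : n₀ ≤ count n₀ pair ℓ i j :=
  count_mono n₀ pair i j (Nat.zero_le ℓ)

lemma totalCount_eq (ℓ : ℕ) : totalCount n₀ pair ℓ = totalCount n₀ pair 0 + ℓ := by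
  induction ℓ with
  | zero => rfl
  | succ ℓ ih =>
    have : totalCount n₀ pair (ℓ + 1) = totalCount n₀ pair ℓ + 1 := by
      simp only [totalCount, count, Finset.sum_add_distrib]
      congr 1
      rw [← Finset.sum_product' Finset.univ Finset.univ
        (fun i j => if pair ℓ = (i, j) then 1 else 0)]
      simp
    omega

lemma tendsto_totalCount : Tendsto (fun ℓ => (totalCount n₀ pair ℓ : ℝ)) atTop atTop := by
  refine tendsto_natCast_atTop_atTop.comp (tendsto_atTop_mono (fun ℓ => ?_) tendsto_id)
  rw [totalCount_eq, id]
  omega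

/-- If the simulated pairs maximize the deficits with respect to target allocations that converge
to `α`, then the empirical allocations converge to `α`. -/
lemma tendsto_count_div_totalCount {aHat : ℕ → Fin K → Fin D → ℝ} {α : Fin K → Fin D → ℝ}
    (hchoice : ∀ ℓ i j,
      aHat ℓ i j * (1 + (totalCount n₀ pair ℓ : ℝ)) - (count n₀ pair ℓ i j : ℝ) ≤
        aHat ℓ (pair ℓ).1 (pair ℓ).2 * (1 + (totalCount n₀ pair ℓ : ℝ)) -
          (count n₀ pair ℓ (pair ℓ).1 (pair ℓ).2 : ℝ))
    (hsum : ∀ᶠ ℓ in atTop, ∑ i, ∑ j, aHat ℓ i j = 1)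
    (hα : ∀ i j, Tendsto (fun ℓ => aHat ℓ i j) atTop (𝓝 (α i j)))
    (hα_nonneg : ∀ i j, 0 ≤ α i j) (i : Fin K) (j : Fin D) :
    Tendsto (fun ℓ => (count n₀ pair ℓ i j : ℝ) / (totalCount n₀ pair ℓ : ℝ)) atTop
      (𝓝 (α i j)) := by
  have hN := tendsto_totalCount n₀ pair
  -- The deficits sum to `(1 + N) - N = 1`, so the largest one is positive: a pair is simulated only
  -- while it is below its target.
  have hdef : ∀ᶠ ℓ in atTop, (count n₀ pair ℓ (pair ℓ).1 (pair ℓ).2 : ℝ) <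
      aHat ℓ (pair ℓ).1 (pair ℓ).2 * (1 + (totalCount n₀ pair ℓ : ℝ)) := by
    filter_upwards [hsum] with ℓ hℓ
    by_contra! hcon
    have h1 : ∑ i, ∑ j, (aHat ℓ i j * (1 + (totalCount n₀ pair ℓ : ℝ)) -
        (count n₀ pair ℓ i j : ℝ)) ≤ 0 :=
      Finset.sum_nonpos fun i _ => Finset.sum_nonpos fun j _ =>
        (hchoice ℓ i j).trans (sub_nonpos.2 hcon)
    simp only [Finset.sum_sub_distrib, ← Finset.sum_mul, hℓ] at h1
    simp only [totalCount] at h1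
    push_cast at h1
    linarith
  have hαsum : ∑ i, ∑ j, α i j = 1 :=
    tendsto_nhds_unique (tendsto_finsetSum _ fun i _ => tendsto_finsetSum _ fun j _ => hα i j)
      (tendsto_const_nhds.congr' (hsum.mono fun _ h => h.symm))
  -- Since `u` and `α` have the same total mass, upper bounds on all entries imply lower bounds;
  -- only upper bounds remain to be shown.
  have hlower : ∀ (u : Fin K → Fin D → ℝ) (ε : ℝ), 0 < ε → (∀ i j, u i j ≤ α i j + ε) →
      ∑ i, ∑ j, u i j = 1 → ∀ i j, α i j - (K * D : ℕ) * ε ≤ u i j := by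
    intro u ε hε hu hu1 i j
    have h1 : ∑ p : Fin K × Fin D, (α p.1 p.2 + ε - u p.1 p.2) = (K * D : ℕ) * ε := by
      simp only [Finset.sum_sub_distrib, Finset.sum_add_distrib, Fintype.sum_prod_type, hu1, hαsum]
      simp
      ring
    have h2 := Finset.single_le_sum (f := fun p : Fin K × Fin D => α p.1 p.2 + ε - u p.1 p.2)
      (s := Finset.univ) (fun p _ => sub_nonneg.2 (hu p.1 p.2)) (Finset.mem_univ (i, j))
    rw [h1] at h2
    simp only at h2
    linarith
  have hub : ∀ ε, 0 < ε → ∀ i j, ∀ᶠ ℓ in atTop,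
      (count n₀ pair ℓ i j : ℝ) / (totalCount n₀ pair ℓ : ℝ) ≤ α i j + ε := by
    intro ε hε i j
    have hβ : 0 ≤ α i j + ε / 2 := add_nonneg (hα_nonneg i j) (half_pos hε).le
    obtain ⟨L, hL⟩ := eventually_atTop.1 (hdef.and
      ((hα i j).eventually_lt_const (lt_add_of_pos_right (α i j) (half_pos hε))))
    -- `C` absorbs the count at time `L`. The condition `1 ≤ C` pays for the overshoot by one when
    -- the pair is simulated from just below its target.
    obtain ⟨C, hC, hC1⟩ : ∃ C : ℝ, (count n₀ pair L i j : ℝ) ≤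
        C + (α i j + ε / 2) * totalCount n₀ pair L ∧ 1 ≤ C :=
      ⟨max 1 (count n₀ pair L i j - (α i j + ε / 2) * totalCount n₀ pair L),
        by linarith [le_max_right 1 (count n₀ pair L i j -
          (α i j + ε / 2) * (totalCount n₀ pair L : ℝ))], le_max_left _ _⟩
    have hbound : ∀ ℓ, L ≤ ℓ → (count n₀ pair ℓ i j : ℝ) ≤
        C + (α i j + ε / 2) * totalCount n₀ pair ℓ := by
      intro ℓ hℓ
      induction ℓ, hℓ using Nat.le_induction with
      | base => exact hC
      | succ ℓ hℓ ih =>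
        have hT : (totalCount n₀ pair (ℓ + 1) : ℝ) = totalCount n₀ pair ℓ + 1 := by
          rw [totalCount_eq, totalCount_eq n₀ pair ℓ]
          push_cast
          ring
        rw [hT]
        by_cases hp : pair ℓ = (i, j)
        · obtain ⟨h1, h2⟩ := hL ℓ hℓ
          rw [hp] at h1
          have h3 := mul_le_mul_of_nonneg_right h2.le
            (by positivity : (0 : ℝ) ≤ 1 + totalCount n₀ pair ℓ)
          simp only [count, hp, if_true]
          push_cast
          linarith
        · simp only [count, if_neg hp, add_zero]
          linarith
    have hC0 : Tendsto (fun ℓ => C / (totalCount n₀ pair ℓ : ℝ)) atTop (𝓝 0) :=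
      hN.const_div_atTop C
    filter_upwards [eventually_ge_atTop L, hN.eventually_gt_atTop 0,
      hC0.eventually_lt_const (half_pos hε)] with ℓ h1 h2 h3
    have h4 := hbound ℓ h1
    rw [div_lt_iff₀ h2] at h3
    rw [div_le_iff₀ h2]
    linarith
  rw [Metric.tendsto_nhds]
  intro ε hε
  have hKD : (0 : ℝ) < (K * D : ℕ) + 1 := by positivity
  have hδ : 0 < ε / 2 / ((K * D : ℕ) + 1) := by positivity
  filter_upwards [eventually_all.2 fun i => eventually_all.2 fun j => hub _ hδ i j,
    hN.eventually_gt_atTop 0] with ℓ h1 h2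
  have h3 := hlower (fun i j => (count n₀ pair ℓ i j : ℝ) / (totalCount n₀ pair ℓ : ℝ)) _ hδ h1 (by
    simp only [← Finset.sum_div]
    rw [div_eq_one_iff_eq h2.ne', totalCount]
    push_cast
    rfl) i j
  have h4 := h1 i j
  have h5 : ((K * D : ℕ) + 1) * (ε / 2 / ((K * D : ℕ) + 1)) = ε / 2 := by
    field_simp
  have h6 : (0 : ℝ) ≤ (K * D : ℕ) * (ε / 2 / ((K * D : ℕ) + 1)) := by positivity
  rw [Real.dist_eq, abs_lt]
  constructor <;> linarith

end Count

/-! ### Growth of the stage index -/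

lemma tendsto_stageOf {n : ℕ → ℕ} (hn : Tendsto (cumulative n) atTop atTop) :
    Tendsto (fun ℓ => stageOf n (ℓ + 1)) atTop atTop := by
  refine tendsto_atTop.2 fun t => ?_
  filter_upwards [eventually_ge_atTop (cumulative n t)] with ℓ hℓ
  obtain ⟨T, hT⟩ := eventually_atTop.1 (hn.eventually_ge_atTop (ℓ + 1))
  -- The set must be shown bounded, since `sSup` of an unbounded set of naturals is 0; the infinite
  -- total budget supplies the bound `T`. Stage `t + 1` belongs to the set.
  refine (Nat.le_succ t).trans (le_csSup ⟨T, fun u hu => ?_⟩ ⟨Nat.succ_pos t, ?_⟩)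
  · by_contra! hlt
    exact (hT (u - 1) (by omega)).not_gt hu.2
  · simpa using Nat.lt_succ_of_le hℓ

/-! ### Consistency of the maximum likelihood estimates -/

section MLE

variable {Ξ : Type*} {D : ℕ}

/-- The density `∑ j, w j * f j` of the mixture with weights `w`. -/
def mixtureDensity (f : Fin D → Ξ → ℝ≥0) (w : Fin D → ℝ) (x : Ξ) : ℝ := ∑ j, w j * (f j x : ℝ)

/-- The density ratio of the mixtures with weights `w` and `wc`. -/
noncomputable def densityRatio (f : Fin D → Ξ → ℝ≥0) (wc w : Fin D → ℝ) (x : Ξ) : ℝ :=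
  mixtureDensity f w x / mixtureDensity f wc x

/-- A weighted `ℓ¹` distance of weight vectors. -/
noncomputable def weightDist (wc w w' : Fin D → ℝ) : ℝ := ∑ j, |w j - w' j| / wc j

lemma mixtureDensity_nonneg (f : Fin D → Ξ → ℝ≥0) {w : Fin D → ℝ} (hw : ∀ j, 0 ≤ w j) (x : Ξ) :
    0 ≤ mixtureDensity f w x :=
  Finset.sum_nonneg fun j _ => mul_nonneg (hw j) (f j x).coe_nonneg

lemma densityRatio_nonneg (f : Fin D → Ξ → ℝ≥0) {wc w : Fin D → ℝ} (hwc : ∀ j, 0 < wc j)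
    (hw : ∀ j, 0 ≤ w j) (x : Ξ) : 0 ≤ densityRatio f wc w x :=
  div_nonneg (mixtureDensity_nonneg f hw x) (mixtureDensity_nonneg f (fun j => (hwc j).le) x)

/-- The true mixture density contains the term `wc j * f j`, so the ratio of `f j` to it is at most
`1 / wc j`. This Lipschitz bound, uniform in `x`, replaces any integrability assumption on
log-likelihoods. -/
lemma abs_densityRatio_sub_le (f : Fin D → Ξ → ℝ≥0) {wc : Fin D → ℝ} (hwc : ∀ j, 0 < wc j)
    (w w' : Fin D → ℝ) (x : Ξ) :
    |densityRatio f wc w x - densityRatio f wc w' x| ≤ weightDist wc w w' := by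
  have h1 : densityRatio f wc w x - densityRatio f wc w' x =
      ∑ j, (w j - w' j) * (f j x / mixtureDensity f wc x) := by
    rw [densityRatio, densityRatio, ← sub_div, mixtureDensity, mixtureDensity,
      ← Finset.sum_sub_distrib, Finset.sum_div]
    refine Finset.sum_congr rfl fun j _ => ?_
    ring
  rw [h1]
  refine (Finset.abs_sum_le_sum_abs _ _).trans (Finset.sum_le_sum fun j _ => ?_)
  have h0 := mixtureDensity_nonneg f (fun j => (hwc j).le) x
  rw [abs_mul, div_eq_mul_one_div |w j - w' j|]
  refine mul_le_mul_of_nonneg_left ?_ (abs_nonneg _)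
  rw [abs_of_nonneg (div_nonneg (f j x).coe_nonneg h0)]
  rcases h0.eq_or_lt with h | h
  -- Where the true density vanishes, the ratio is 0 by convention.
  · rw [← h, div_zero]
    exact (one_div_pos.2 (hwc j)).le
  · rw [div_le_div_iff₀ h (hwc j), one_mul, mul_comm]
    exact Finset.single_le_sum (f := fun j => wc j * (f j x : ℝ))
      (fun j _ => mul_nonneg (hwc j).le (f j x).coe_nonneg) (Finset.mem_univ j)

/-- Subadditivity of the square root. Negative arguments are allowed because the comparison weights
come from a dense sequence in the whole space, where density ratios may be negative. -/
lemma abs_sqrt_sub_sqrt_le (a b : ℝ) : |√a - √b| ≤ √|a - b| := by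
  wlog h : b ≤ a generalizing a b
  · rw [abs_sub_comm, abs_sub_comm a]
    exact this b a (le_of_not_ge h)
  rw [abs_of_nonneg (sub_nonneg.2 (Real.sqrt_le_sqrt h)), abs_of_nonneg (sub_nonneg.2 h),
    sub_le_iff_le_add]
  calc √a ≤ √((a - b) + max b 0) := Real.sqrt_le_sqrt (by linarith [le_max_left b 0])
    _ ≤ √(a - b) + √(max b 0) := by
        have h1 := Real.sq_sqrt (sub_nonneg.2 h)
        have h2 := Real.sq_sqrt (le_max_right b 0)
        have h3 := mul_nonneg (Real.sqrt_nonneg (a - b)) (Real.sqrt_nonneg (max b 0))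
        refine Real.sqrt_le_iff.2 ⟨by positivity, ?_⟩
        rw [add_sq, h1, h2]
        linarith
    _ = √(a - b) + √b := by
        rcases le_total b 0 with hb | hb
        · rw [max_eq_right hb, Real.sqrt_zero, Real.sqrt_eq_zero_of_nonpos hb]
        · rw [max_eq_left hb]

lemma sqrt_densityRatio_le (f : Fin D → Ξ → ℝ≥0) {wc : Fin D → ℝ} (hwc : ∀ j, 0 < wc j)
    (w w' : Fin D → ℝ) (x : Ξ) :
    √(densityRatio f wc w x) ≤ √(densityRatio f wc w' x) + √(weightDist wc w w') := by
  have h1 := abs_sqrt_sub_sqrt_le (densityRatio f wc w x) (densityRatio f wc w' x)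
  have h2 := Real.sqrt_le_sqrt (abs_densityRatio_sub_le f hwc w w' x)
  linarith [le_abs_self (√(densityRatio f wc w x) - √(densityRatio f wc w' x))]

lemma weightDist_comm (wc w w' : Fin D → ℝ) : weightDist wc w w' = weightDist wc w' w := by
  simp only [weightDist, abs_sub_comm]

lemma continuous_weightDist (wc w : Fin D → ℝ) : Continuous fun w' => weightDist wc w w' := by
  unfold weightDist
  fun_prop

lemma weightDist_self (wc w : Fin D → ℝ) : weightDist wc w w = 0 := by
  simp [weightDist]

/-- The average of the square roots of the density ratios is at least `1` at a maximum likelihood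
estimate. -/
lemma IsMLE.le_sum_sqrt_densityRatio {f : Fin D → Ξ → ℝ≥0} {wc : Fin D → ℝ}
    (hwc : wc ∈ stdSimplex ℝ (Fin D)) {ξ : ℕ → Ξ} (hξ : ∀ s, 0 < mixtureDensity f wc (ξ s))
    {M : ℕ} {w : Fin D → ℝ} (hw : IsMLE f ξ M w) :
    (M : ℝ) ≤ ∑ s ∈ Finset.range M, √(densityRatio f wc w (ξ s)) := by
  have h1 : 1 ≤ ∏ s ∈ Finset.range M, √(densityRatio f wc w (ξ s)) := by
    have hr : ∀ s ∈ Finset.range M, 0 ≤ densityRatio f wc w (ξ s) := fun s _ =>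
      div_nonneg (mixtureDensity_nonneg f hw.1.1 _) (hξ s).le
    rw [← Real.sqrt_prod _ hr, Real.one_le_sqrt]
    simp only [densityRatio]
    rw [Finset.prod_div_distrib, one_le_div (Finset.prod_pos fun s _ => hξ s)]
    exact hw.2 wc hwc
  -- The bound `y ≤ exp (y - 1)` turns the product, which is at least 1 at a maximizer, into a sum.
  have h2 : ∏ s ∈ Finset.range M, √(densityRatio f wc w (ξ s)) ≤
      Real.exp (∑ s ∈ Finset.range M, (√(densityRatio f wc w (ξ s)) - 1)) := by
    rw [Real.exp_sum]
    refine Finset.prod_le_prod (fun _ _ => Real.sqrt_nonneg _) fun s _ => ?_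
    linarith [Real.add_one_le_exp (√(densityRatio f wc w (ξ s)) - 1)]
  have h3 := Real.one_le_exp_iff.1 (h1.trans h2)
  rw [Finset.sum_sub_distrib] at h3
  simpa using h3

variable [MeasurableSpace Ξ]

lemma measurable_mixtureDensity {f : Fin D → Ξ → ℝ≥0} (hf : ∀ j, Measurable (f j))
    (w : Fin D → ℝ) : Measurable (mixtureDensity f w) := by
  unfold mixtureDensity
  fun_prop

lemma measurable_densityRatio {f : Fin D → Ξ → ℝ≥0} (hf : ∀ j, Measurable (f j))
    (wc w : Fin D → ℝ) : Measurable (densityRatio f wc w) :=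
  (measurable_mixtureDensity hf w).div (measurable_mixtureDensity hf wc)

lemma mixture_eq_withDensity {F : Fin D → Measure Ξ} {ν : Measure Ξ} {f : Fin D → Ξ → ℝ≥0}
    (hf : ∀ j, Measurable (f j)) (hF : ∀ j, F j = ν.withDensity (fun y => (f j y : ℝ≥0∞)))
    {w : Fin D → ℝ} (hw : ∀ j, 0 ≤ w j) :
    mixture F w = ν.withDensity fun x => ENNReal.ofReal (mixtureDensity f w x) := by
  ext A hA
  have h1 : ∀ x, ENNReal.ofReal (mixtureDensity f w x) =
      ∑ j, ENNReal.ofReal (w j) * (f j x : ℝ≥0∞) := by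
    intro x
    rw [mixtureDensity, ENNReal.ofReal_sum_of_nonneg fun j _ => mul_nonneg (hw j) (f j x).coe_nonneg]
    refine Finset.sum_congr rfl fun j _ => ?_
    rw [ENNReal.ofReal_mul (hw j), ENNReal.ofReal_coe_nnreal]
  simp only [mixture, Measure.finsetSum_apply, Measure.smul_apply, hF, withDensity_apply _ hA,
    smul_eq_mul, h1]
  rw [lintegral_finsetSum _ fun j _ => by fun_prop]
  refine Finset.sum_congr rfl fun j _ => ?_
  rw [lintegral_const_mul _ (by fun_prop)]

lemma isProbabilityMeasure_mixture (F : Fin D → Measure Ξ) [∀ j, IsProbabilityMeasure (F j)]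
    {w : Fin D → ℝ} (hw : w ∈ stdSimplex ℝ (Fin D)) : IsProbabilityMeasure (mixture F w) := by
  constructor
  simp only [mixture, Measure.finsetSum_apply, Measure.smul_apply, measure_univ, smul_eq_mul,
    mul_one]
  rw [← ENNReal.ofReal_sum_of_nonneg fun j _ => hw.1 j, hw.2, ENNReal.ofReal_one]

lemma hellinger_self (Q : Measure Ξ) : hellinger Q Q = 0 := by
  simp [hellinger]

lemma integrable_sqrt_densityRatio {f : Fin D → Ξ → ℝ≥0} (hf : ∀ j, Measurable (f j))
    {wc : Fin D → ℝ} (hwc : ∀ j, 0 < wc j) (w : Fin D → ℝ) (Q : Measure Ξ) [IsFiniteMeasure Q] :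
    Integrable (fun x => √(densityRatio f wc w x)) Q := by
  refine Integrable.of_bound (measurable_densityRatio hf wc w).sqrt.aestronglyMeasurable
    (√(weightDist wc w 0)) (ae_of_all _ fun x => ?_)
  rw [Real.norm_eq_abs, abs_of_nonneg (Real.sqrt_nonneg _)]
  -- Comparison with the zero weight vector, whose density ratio is 0.
  simpa [densityRatio, mixtureDensity] using sqrt_densityRatio_le f hwc w 0 x

/-! ### Hellinger affinity and consistency of the weight estimates -/

section

variable {F : Fin D → Measure Ξ} [∀ j, IsProbabilityMeasure (F j)] {ν : Measure Ξ}
  {f : Fin D → Ξ → ℝ≥0} (hf : ∀ j, Measurable (f j))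
  (hF : ∀ j, F j = ν.withDensity (fun y => (f j y : ℝ≥0∞)))
  {wc : Fin D → ℝ} (hwc_pos : ∀ j, 0 < wc j) (hwc_sum : ∑ j, wc j = 1)
include hf hF hwc_pos hwc_sum

omit hwc_sum in
-- Multiplying the ratio by the true density returns the density for `w`, or 0 where the true
-- density vanishes; the inequality suffices below.
lemma integral_densityRatio_le {w : Fin D → ℝ} (hw : w ∈ stdSimplex ℝ (Fin D)) :
    ∫ x, densityRatio f wc w x ∂(mixture F wc) ≤ 1 := by
  have hwc0 : ∀ j, 0 ≤ wc j := fun j => (hwc_pos j).le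
  rw [integral_eq_lintegral_of_nonneg_ae
    (ae_of_all _ (densityRatio_nonneg f hwc_pos hw.1))
    (measurable_densityRatio hf wc w).aestronglyMeasurable]
  refine ENNReal.toReal_le_of_le_ofReal zero_le_one ?_
  have := isProbabilityMeasure_mixture F hw
  have h1 : ∫⁻ x, ENNReal.ofReal (mixtureDensity f w x) ∂ν = 1 := by
    have := measure_univ (μ := mixture F w)
    rwa [mixture_eq_withDensity hf hF hw.1, withDensity_apply _ MeasurableSet.univ,
      Measure.restrict_univ] at this
  rw [ENNReal.ofReal_one, ← h1, mixture_eq_withDensity hf hF hwc0,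
    lintegral_withDensity_eq_lintegral_mul _ (measurable_mixtureDensity hf wc).ennreal_ofReal
      (measurable_densityRatio hf wc w).ennreal_ofReal]
  refine lintegral_mono fun x => ?_
  have h0 := mixtureDensity_nonneg f hwc0 x
  simp only [Pi.mul_apply]
  rw [← ENNReal.ofReal_mul h0]
  refine ENNReal.ofReal_le_ofReal ?_
  rcases h0.eq_or_lt with h | h
  · rw [← h, zero_mul]
    exact mixtureDensity_nonneg f hw.1 x
  · rw [densityRatio, mul_div_cancel₀ _ h.ne']

/-- With `r` the density ratio, `∫ (√r - 1)² = ∫ r - 2 ∫ √r + 1 ≤ 2 - 2 ∫ √r`. If `∫ √r ≥ 1`, then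
`r = 1` almost everywhere and the two mixtures coincide, against identifiability. -/
lemma integral_sqrt_densityRatio_lt (hident : Identifiable F wc) {w : Fin D → ℝ}
    (hw : w ∈ stdSimplex ℝ (Fin D)) (hne : w ≠ wc) :
    ∫ x, √(densityRatio f wc w x) ∂(mixture F wc) < 1 := by
  have hwc0 : ∀ j, 0 ≤ wc j := fun j => (hwc_pos j).le
  have := isProbabilityMeasure_mixture F ⟨hwc0, hwc_sum⟩
  by_contra! hcon
  refine hident w hw hne ?_
  have hi1 := integrable_sqrt_densityRatio hf hwc_pos w (mixture F wc)
  have hi2 : Integrable (densityRatio f wc w) (mixture F wc) := by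
    refine Integrable.of_bound (measurable_densityRatio hf wc w).aestronglyMeasurable
      (weightDist wc w 0) (ae_of_all _ fun x => ?_)
    simpa [densityRatio, mixtureDensity, abs_div] using abs_densityRatio_sub_le f hwc_pos w 0 x
  have hsq : ∀ x, (√(densityRatio f wc w x) - 1) ^ 2 =
      densityRatio f wc w x - 2 * √(densityRatio f wc w x) + 1 := by
    intro x
    rw [sub_sq, Real.sq_sqrt (densityRatio_nonneg f hwc_pos hw.1 x)]
    ring
  have hi3 : Integrable (fun x => (√(densityRatio f wc w x) - 1) ^ 2) (mixture F wc) := by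
    simp only [hsq]
    exact (hi2.sub (hi1.const_mul 2)).add (integrable_const 1)
  have h0 : ∫ x, (√(densityRatio f wc w x) - 1) ^ 2 ∂(mixture F wc) = 0 := by
    refine le_antisymm ?_ (integral_nonneg fun x => sq_nonneg _)
    simp only [hsq]
    rw [integral_add (f := fun x => densityRatio f wc w x - 2 * √(densityRatio f wc w x))
      (hi2.sub (hi1.const_mul 2)) (integrable_const 1),
      integral_sub hi2 (hi1.const_mul 2), integral_const_mul]
    have := integral_densityRatio_le hf hF hwc_pos hw
    simp
    linarith
  rw [integral_eq_zero_iff_of_nonneg (fun x => sq_nonneg _) hi3,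
    mixture_eq_withDensity hf hF hwc0, Filter.EventuallyEq,
    ae_withDensity_iff (measurable_mixtureDensity hf wc).ennreal_ofReal] at h0
  have hmix : mixture F w = mixture F wc := by
    rw [mixture_eq_withDensity hf hF hw.1, mixture_eq_withDensity hf hF hwc0]
    refine withDensity_congr_ae ?_
    filter_upwards [h0] with x hx
    congr 1
    rcases (mixtureDensity_nonneg f hwc0 x).eq_or_lt with h | h
    -- The almost sure identity says nothing where the true density is 0; there all components
    -- vanish because every true weight is positive.
    · have hz : ∀ j, (f j x : ℝ) = 0 := by
        intro j
        have := (Finset.sum_eq_zero_iff_of_nonneg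
          (fun j _ => mul_nonneg (hwc0 j) (f j x).coe_nonneg)).1 h.symm j (Finset.mem_univ j)
        exact (mul_eq_zero.1 this).resolve_left (hwc_pos j).ne'
      simp [mixtureDensity, hz]
    · have h1 := hx (ENNReal.ofReal_pos.2 h).ne'
      simp only [Pi.zero_apply, sq_eq_zero_iff, sub_eq_zero, Real.sqrt_eq_one] at h1
      rwa [densityRatio, div_eq_one_iff_eq h.ne'] at h1
  rw [hmix, hellinger_self]

/-- Strong consistency of the maximum likelihood estimates of the weights. -/
lemma ae_tendsto_of_isMLE (hident : Identifiable F wc)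
    {Ω : Type*} [MeasurableSpace Ω] {P : Measure Ω}
    {ξ : ℕ → Ω → Ξ} (hξ_law : ∀ s, HasLaw (ξ s) (mixture F wc) P) (hξ_indep : iIndepFun ξ P) :
    ∀ᵐ ω ∂P, ∀ (M : ℕ → ℕ) (w : ℕ → Fin D → ℝ), Tendsto M atTop atTop →
      (∀ᶠ t in atTop, IsMLE f (fun s => ξ s ω) (M t) (w t)) → Tendsto w atTop (𝓝 wc) := by
  have hwc : wc ∈ stdSimplex ℝ (Fin D) := ⟨fun j => (hwc_pos j).le, hwc_sum⟩
  have := isProbabilityMeasure_mixture F hwc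
  have hpos : ∀ᵐ ω ∂P, ∀ s, 0 < mixtureDensity f wc (ξ s ω) := by
    refine ae_all_iff.2 fun s => ?_
    have hmeas := measurable_mixtureDensity hf wc
    rw [(hξ_law s).ae_iff (p := fun x => 0 < mixtureDensity f wc x)
      (measurableSet_setOfPred.1 (measurableSet_lt measurable_const hmeas)),
      mixture_eq_withDensity hf hF hwc.1, ae_withDensity_iff hmeas.ennreal_ofReal]
    refine ae_of_all _ fun x hx => ?_
    simpa using hx
  -- The strong law is invoked only at countably many weight vectors; the uniform Hölder bound
  -- transfers it to the random ones.
  have hslln : ∀ᵐ ω ∂P, ∀ k : ℕ, Tendsto (fun M : ℕ =>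
      (∑ s ∈ Finset.range M,
        √(densityRatio f wc (TopologicalSpace.denseSeq (Fin D → ℝ) k) (ξ s ω))) / M) atTop
      (𝓝 (∫ x, √(densityRatio f wc (TopologicalSpace.denseSeq (Fin D → ℝ) k) x)
        ∂(mixture F wc))) := by
    refine ae_all_iff.2 fun k => ?_
    set q := TopologicalSpace.denseSeq (Fin D → ℝ) k
    have hmeas : Measurable fun x => √(densityRatio f wc q x) :=
      (measurable_densityRatio hf wc q).sqrt
    have hint := integrable_sqrt_densityRatio hf hwc_pos q (mixture F wc)
    have h := strong_law_ae_real (μ := P) (fun s ω => √(densityRatio f wc q (ξ s ω)))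
      (by
        have h1 := hint
        rw [← (hξ_law 0).map_eq] at h1
        exact h1.comp_aemeasurable (hξ_law 0).aemeasurable)
      (fun s s' hss => (hξ_indep.indepFun hss).comp hmeas hmeas)
      (fun s => ((hξ_law s).identDistrib (hξ_law 0)).comp hmeas)
    have h2 : P[fun ω => √(densityRatio f wc q (ξ 0 ω))] =
        ∫ x, √(densityRatio f wc q x) ∂(mixture F wc) :=
      (hξ_law 0).integral_comp hmeas.aestronglyMeasurable
    rwa [h2] at h
  filter_upwards [hpos, hslln] with ω hω hlim M w hM hmle
  -- By compactness of the simplex it suffices to exclude cluster points `v ≠ wc`.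
  refine (isCompact_stdSimplex ℝ (Fin D)).tendsto_nhds_of_unique_mapClusterPt
    (hmle.mono fun t ht => ht.1) fun v hv hcl => ?_
  by_contra hne
  have hφ := integral_sqrt_densityRatio_lt hf hF hwc_pos hwc_sum hident hv hne
  set φ := ∫ x, √(densityRatio f wc v x) ∂(mixture F wc) with hφdef
  -- Four errors of size `δ`: from `v` to `q` in the mean, the strong law at `q`, and from `w t` to
  -- `v` and `v` to `q` in the empirical sum.
  obtain ⟨δ, hδ, hδφ⟩ : ∃ δ > 0, φ + 4 * δ < 1 := ⟨(1 - φ) / 8, by linarith, by linarith⟩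
  have hcont : Continuous fun w' => √(weightDist wc v w') := (continuous_weightDist wc v).sqrt
  have hopen : {w' | √(weightDist wc v w') < δ} ∈ 𝓝 v :=
    (isOpen_lt hcont continuous_const).mem_nhds (by simpa [weightDist_self] using hδ)
  obtain ⟨k, hk⟩ : ∃ k, √(weightDist wc v (TopologicalSpace.denseSeq (Fin D → ℝ) k)) < δ := by
    obtain ⟨q, hq, hk⟩ := (TopologicalSpace.denseRange_denseSeq (Fin D → ℝ)).inter_nhds_nonempty
      hopen
    obtain ⟨⟨k, rfl⟩, hq⟩ := And.intro hq hk
    exact ⟨k, hq⟩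
  have hlimk := hlim k
  set q := TopologicalSpace.denseSeq (Fin D → ℝ) k
  have hφq : ∫ x, √(densityRatio f wc q x) ∂(mixture F wc) ≤ φ + δ := by
    have h1 : ∫ x, √(densityRatio f wc q x) ∂(mixture F wc) ≤
        ∫ x, (√(densityRatio f wc v x) + δ) ∂(mixture F wc) := by
      refine integral_mono (integrable_sqrt_densityRatio hf hwc_pos q _)
        ((integrable_sqrt_densityRatio hf hwc_pos v _).add (integrable_const δ)) fun x => ?_
      have := sqrt_densityRatio_le f hwc_pos q v x
      rw [weightDist_comm] at this
      simp only
      linarith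
    rw [integral_add (integrable_sqrt_densityRatio hf hwc_pos v _) (integrable_const δ)] at h1
    simpa using h1
  have hfreq := (hcl.frequently hopen).and_eventually
    (hmle.and ((hM.eventually (hlimk.eventually_lt_const (lt_add_of_pos_right _ hδ))).and
      (hM.eventually_ge_atTop 1)))
  obtain ⟨t, ht1, ht2, ht3, ht4⟩ := hfreq.exists
  have hMt : (0 : ℝ) < M t := by exact_mod_cast ht4
  have h1 := ht2.le_sum_sqrt_densityRatio hwc hω
  rw [div_lt_iff₀ hMt] at ht3
  have h2 : ∑ s ∈ Finset.range (M t), √(densityRatio f wc (w t) (ξ s ω)) ≤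
      ∑ s ∈ Finset.range (M t), (√(densityRatio f wc q (ξ s ω)) + 2 * δ) := by
    refine Finset.sum_le_sum fun s _ => ?_
    have e1 := sqrt_densityRatio_le f hwc_pos (w t) v (ξ s ω)
    have e2 := sqrt_densityRatio_le f hwc_pos v q (ξ s ω)
    rw [weightDist_comm] at e1
    have ht1' : √(weightDist wc v (w t)) < δ := ht1
    linarith
  rw [Finset.sum_add_distrib, Finset.sum_const, Finset.card_range, nsmul_eq_mul] at h2
  have h3 : (∫ x, √(densityRatio f wc q x) ∂(mixture F wc) + δ) * M t ≤ (φ + 2 * δ) * M t :=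
    mul_le_mul_of_nonneg_right (by linarith) hMt.le
  have h4 : (φ + 4 * δ) * M t < 1 * M t := mul_lt_mul_of_pos_right hδφ hMt
  linarith

end

end MLE

/-! ### The simulation outputs -/

lemma expectedPerf_mixture {Ξ : Type*} [MeasurableSpace Ξ] {D : ℕ} (F : Fin D → Measure Ξ)
    (κ : Kernel Ξ ℝ) {w : Fin D → ℝ} (hw : ∀ j, 0 ≤ w j) {μ : Fin D → ℝ} {v : Fin D → ℝ≥0}
    (hκ : ∀ j, (F j).bind κ = gaussianReal (μ j) (v j)) :
    expectedPerf κ (mixture F w) = ∑ j, w j * μ j := by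
  have h1 : (mixture F w).bind κ = ∑ j, ENNReal.ofReal (w j) • gaussianReal (μ j) (v j) := by
    ext A hA
    rw [Measure.bind_apply hA κ.measurable.aemeasurable, mixture, lintegral_finsetSum_measure,
      Measure.finsetSum_apply]
    refine Finset.sum_congr rfl fun j _ => ?_
    rw [lintegral_smul_measure, Measure.smul_apply, ← hκ,
      Measure.bind_apply hA κ.measurable.aemeasurable]
  rw [expectedPerf, h1, integral_finsetSum_measure]
  · refine Finset.sum_congr rfl fun j _ => ?_
    rw [integral_smul_measure, integral_id_gaussianReal, ENNReal.toReal_ofReal (hw j), smul_eq_mul]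
  · exact fun j _ => ((memLp_id_gaussianReal 1).integrable le_rfl).smul_measure
      ENNReal.ofReal_ne_top

/-- A vanishing sum of squares would make all terms equal the sample mean. Thus the single event `x
0 ≠ x 1` handles every sample size. -/
lemma sampleStd_pos {x : ℕ → ℝ} (hx : x 0 ≠ x 1) {N : ℕ} (hN : 2 ≤ N) : 0 < sampleStd x N := by
  have hN' : (2 : ℝ) ≤ N := by exact_mod_cast hN
  refine Real.sqrt_pos.2 (div_pos ?_ (by linarith))
  refine (Finset.sum_nonneg fun s _ => sq_nonneg _).lt_of_ne' fun h => hx ?_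
  have h1 := (Finset.sum_eq_zero_iff_of_nonneg fun s _ => sq_nonneg _).1 h
  have h2 := h1 0 (Finset.mem_range.2 (by omega))
  have h3 := h1 1 (Finset.mem_range.2 (by omega))
  rw [sq_eq_zero_iff, sub_eq_zero] at h2 h3
  rw [h2, h3]

/-- Expresses the standard deviation by empirical moments, to which the strong law applies. -/
lemma sampleStd_eq {x : ℕ → ℝ} {N : ℕ} (hN : 2 ≤ N) :
    sampleStd x N = √(((∑ s ∈ Finset.range N, x s ^ 2) / N - sampleMean x N ^ 2) *
      (N / ((N : ℝ) - 1))) := by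
  have hN' : (2 : ℝ) ≤ N := by exact_mod_cast hN
  have hN0 : (N : ℝ) ≠ 0 := by linarith
  rw [sampleStd, mul_div, sub_mul, div_mul_cancel₀ _ hN0]
  congr 2
  have h1 : ∑ s ∈ Finset.range N, x s = sampleMean x N * N := by
    rw [sampleMean, div_mul_cancel₀ _ hN0]
  simp only [sub_sq, Finset.sum_add_distrib, Finset.sum_sub_distrib, ← Finset.sum_mul,
    ← Finset.mul_sum, h1, Finset.sum_const, Finset.card_range, nsmul_eq_mul]
  ring

lemma tendsto_sampleStd {x : ℕ → ℝ} {μ σ : ℝ} (hσ : 0 ≤ σ)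
    (h1 : Tendsto (sampleMean x) atTop (𝓝 μ))
    (h2 : Tendsto (fun N : ℕ => (∑ s ∈ Finset.range N, x s ^ 2) / N) atTop (𝓝 (σ ^ 2 + μ ^ 2))) :
    Tendsto (sampleStd x) atTop (𝓝 σ) := by
  have h3 : Tendsto (fun N : ℕ => (N : ℝ) / ((N : ℝ) - 1)) atTop (𝓝 1) := by
    have h4 : Tendsto (fun N : ℕ => 1 + 1 / ((N : ℝ) - 1)) atTop (𝓝 (1 + 0)) :=
      tendsto_const_nhds.add ((tendsto_atTop_add_const_right _ (-1 : ℝ)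
        tendsto_natCast_atTop_atTop).const_div_atTop 1)
    rw [add_zero] at h4
    refine h4.congr' ?_
    filter_upwards [eventually_ge_atTop 2] with N hN
    have hN' : (2 : ℝ) ≤ N := by exact_mod_cast hN
    have : (N : ℝ) - 1 ≠ 0 := by linarith
    field_simp
    ring
  have h5 := ((h2.sub (h1.pow 2)).mul h3).sqrt
  rw [add_sub_cancel_right, mul_one, Real.sqrt_sq hσ] at h5
  refine h5.congr' ?_
  filter_upwards [eventually_ge_atTop 2] with N hN
  rw [sampleStd_eq hN]

section Outputs

variable {Ω : Type*} [MeasurableSpace Ω] {P : Measure Ω}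

lemma ae_tendsto_sampleMean_sampleStd {x : ℕ → Ω → ℝ} {μ : ℝ} {σ : ℝ≥0}
    (hlaw : ∀ r, HasLaw (x r) (gaussianReal μ (σ ^ 2)) P)
    (hindep : Pairwise fun r r' => IndepFun (x r) (x r') P) :
    ∀ᵐ ω ∂P, Tendsto (sampleMean fun r => x r ω) atTop (𝓝 μ) ∧
      Tendsto (sampleStd fun r => x r ω) atTop (𝓝 σ) := by
  have hsq : Measurable fun y : ℝ => y ^ 2 := by fun_prop
  have hint {g : ℝ → ℝ} (hg : Integrable g (gaussianReal μ (σ ^ 2))) :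
      Integrable (fun ω => g (x 0 ω)) P := by
    rw [← (hlaw 0).map_eq] at hg
    exact hg.comp_aemeasurable (hlaw 0).aemeasurable
  have hL2 : MemLp (fun y : ℝ => y) 2 (gaussianReal μ (σ ^ 2)) := memLp_id_gaussianReal 2
  have h1 := strong_law_ae_real (μ := P) x (hint (g := fun y => y) (hL2.integrable one_le_two))
    hindep fun r => (hlaw r).identDistrib (hlaw 0)
  have h2 := strong_law_ae_real (μ := P) (fun r ω => x r ω ^ 2)
    (hint (g := fun y => y ^ 2) hL2.integrable_sq)
    (fun r r' hr => (hindep hr).comp hsq hsq)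
    fun r => ((hlaw r).identDistrib (hlaw 0)).comp hsq
  have e1 : P[x 0] = μ := by rw [(hlaw 0).integral_eq, integral_id_gaussianReal]
  have e2 : P[fun ω => x 0 ω ^ 2] = (σ : ℝ) ^ 2 + μ ^ 2 := by
    have h3 : P[fun ω => x 0 ω ^ 2] = ∫ y, y ^ 2 ∂(gaussianReal μ (σ ^ 2)) :=
      (hlaw 0).integral_comp hsq.aestronglyMeasurable
    have h4 := variance_eq_sub hL2
    rw [variance_fun_id_gaussianReal, integral_id_gaussianReal] at h4
    simp only [Pi.pow_apply] at h4
    rw [h3]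
    push_cast at h4
    linarith
  rw [e1] at h1
  rw [e2] at h2
  filter_upwards [h1, h2] with ω hω1 hω2
  exact ⟨hω1, tendsto_sampleStd σ.coe_nonneg hω1 hω2⟩

/-- A linear combination, with a nonzero coefficient, of independent random variables without atoms
has no atoms. -/
lemma ae_sum_mul_ne [IsProbabilityMeasure P] {ι : Type*} [DecidableEq ι] {X : ι → Ω → ℝ}
    (hX : ∀ p, AEMeasurable (X p) P) (hatom : ∀ p, NullSingletonClass (P.map (X p)))
    (hindep : iIndepFun X P) (s : Finset ι) (c : ι → ℝ) (d : ℝ) {p : ι} (hp : p ∈ s)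
    (hc : c p ≠ 0) : ∀ᵐ ω ∂P, ∑ q ∈ s, c q * X q ω ≠ d := by
  have hZ : ∀ q, AEMeasurable (fun ω => c q * X q ω) P := fun q => (hX q).const_mul _
  have hZindep : iIndepFun (fun q ω => c q * X q ω) P :=
    hindep.comp (fun q y => c q * y) fun q => measurable_const_mul (c q)
  have h1 := hZindep.indepFun_finsetSum_of_notMem₀ hZ (Finset.notMem_erase p s)
  have hY : AEMeasurable (∑ q ∈ s.erase p, fun ω => c q * X q ω) P :=
    Finset.aemeasurable_sum _ fun q _ => hZ q
  have h2 := (indepFun_iff_map_prod_eq_prod_map_map hY (hZ p)).1 h1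
  have hA : MeasurableSet {y : ℝ × ℝ | y.1 + y.2 = d} :=
    measurableSet_eq_fun (by fun_prop) measurable_const
  have := Measure.isProbabilityMeasure_map (hZ p)
  -- Fubini: with the sum of the other terms fixed at `y`, the equation pins `X p` to a single
  -- value.
  have h3 : P.map (fun ω => ((∑ q ∈ s.erase p, fun ω => c q * X q ω) ω, c p * X p ω))
      {y : ℝ × ℝ | y.1 + y.2 = d} = 0 := by
    rw [h2, Measure.measure_prod_null hA]
    refine ae_of_all _ fun y => ?_
    simp only [Pi.zero_apply]
    rw [Measure.map_apply_of_aemeasurable (hZ p) (measurable_prodMk_left hA)]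
    have h4 : (fun ω => c p * X p ω) ⁻¹' (Prod.mk y ⁻¹' {y : ℝ × ℝ | y.1 + y.2 = d}) =
        X p ⁻¹' {(d - y) / c p} := by
      ext ω
      simp only [Set.mem_preimage, Set.mem_ofPred_eq, Set.mem_singleton_iff, eq_div_iff hc]
      constructor <;> intro h <;> linarith
    rw [h4, ← Measure.map_apply_of_aemeasurable (hX p) (measurableSet_singleton _)]
    have := hatom p
    exact measure_singleton _
  rw [Measure.map_apply_of_aemeasurable (hY.prodMk (hZ p)) hA] at h3
  rw [ae_iff]
  convert h3 using 2
  ext ω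
  simp only [ne_eq, not_not, Set.mem_ofPred_eq, Set.mem_preimage, Finset.sum_apply]
  rw [Finset.sum_erase_add _ _ hp]

/-! ### Absence of ties among the outputs and the limiting estimates -/

variable {K D : ℕ} {X : Fin K → Fin D → ℕ → Ω → ℝ} [IsProbabilityMeasure P]
  (hX : ∀ i j r, AEMeasurable (X i j r) P)
  (hatom : ∀ i j r, NullSingletonClass (P.map (X i j r)))
  (hindep : iIndepFun (fun p : Fin K × Fin D × ℕ => X p.1 p.2.1 p.2.2) P)
include hX hatom hindep

lemma ae_output_ne (i : Fin K) (j : Fin D) : ∀ᵐ ω ∂P, X i j 0 ω ≠ X i j 1 ω := by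
  filter_upwards [ae_sum_mul_ne (fun p => hX p.1 p.2.1 p.2.2) (fun p => hatom p.1 p.2.1 p.2.2)
    hindep {(i, j, 0), (i, j, 1)} (fun p => if p.2.2 = 0 then 1 else -1) 0
    (p := (i, j, 0)) (by simp) (by simp)] with ω hω h
  refine hω ?_
  rw [Finset.sum_pair (by simp)]
  simp [h]

lemma ae_sum_sampleMean_ne (u : Fin K → ℝ) {w : Fin D → ℝ} (hw : ∀ j, 0 < w j)
    (N : Fin K → Fin D → ℕ) (d : ℝ) {i : Fin K} {j : Fin D} (hu : u i ≠ 0) (hN : N i j ≠ 0) :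
    ∀ᵐ ω ∂P, ∑ k, u k * ∑ l, w l * sampleMean (fun r => X k l r ω) (N k l) ≠ d := by
  have hle : ∀ k l, N k l ≤ ∑ k, ∑ l, N k l := fun k l =>
    (Finset.single_le_sum (f := fun l => N k l) (fun _ _ => Nat.zero_le _)
      (Finset.mem_univ l)).trans
    (Finset.single_le_sum (f := fun k => ∑ l, N k l) (fun _ _ => Nat.zero_le _)
      (Finset.mem_univ k))
  filter_upwards [ae_sum_mul_ne (fun p => hX p.1 p.2.1 p.2.2) (fun p => hatom p.1 p.2.1 p.2.2)
    -- All pairs share one index range, padded with zero coefficients beyond `N k l`; the output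
    -- `(i, j, 0)` has a nonzero coefficient.
    hindep (Finset.univ ×ˢ Finset.univ ×ˢ Finset.range (∑ k, ∑ l, N k l))
    (fun p => u p.1 * (w p.2.1 * if p.2.2 < N p.1 p.2.1 then 1 / (N p.1 p.2.1 : ℝ) else 0)) d
    (p := (i, j, 0)) (by simpa using (Nat.pos_of_ne_zero hN).trans_le (hle i j))
    (by simp [hu, (hw j).ne', hN, Nat.pos_of_ne_zero hN])] with ω hω h
  refine hω ?_
  rw [← h, Finset.sum_product]
  refine Finset.sum_congr rfl fun k _ => ?_
  rw [Finset.sum_product, Finset.mul_sum]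
  refine Finset.sum_congr rfl fun l _ => ?_
  have h1 : ∑ r ∈ Finset.range (∑ k, ∑ l, N k l),
      (if r < N k l then 1 / (N k l : ℝ) else 0) * X k l r ω =
      sampleMean (fun r => X k l r ω) (N k l) := by
    rw [sampleMean, Finset.sum_div]
    refine (Finset.sum_subset (Finset.range_subset_range.2 (hle k l)) fun r _ hr => ?_).symm.trans
      (Finset.sum_congr rfl fun r hr => ?_)
    · rw [if_neg (by simpa using hr), zero_mul]
    · rw [if_pos (Finset.mem_range.1 hr), one_div_mul_eq_div]
  rw [← h1, Finset.mul_sum, Finset.mul_sum]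
  refine Finset.sum_congr rfl fun r _ => ?_
  ring

/-- Almost surely, the performances that are estimated with some of the sample means replaced by
their limits are pairwise distinct, provided that the true performances are. Here `N i j = 0` stands
for an infinite number of outputs. -/
lemma ae_perf_ne {w : Fin D → ℝ} (hw : ∀ j, 0 < w j) {μ : Fin K → Fin D → ℝ}
    (hμ : Function.Injective fun i => ∑ j, w j * μ i j) :
    ∀ᵐ ω ∂P, ∀ N : Fin K → Fin D → ℕ, Function.Injective fun i =>
      ∑ j, w j * if N i j = 0 then μ i j else sampleMean (fun r => X i j r ω) (N i j) := by
  -- The limiting counts are random, but there are only countably many arrays `N`, so a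
  -- deterministic one suffices.
  refine ae_all_iff.2 fun N => ?_
  simp only [Function.Injective, ae_all_iff]
  intro i i'
  by_cases hii : i = i'
  · simp [hii]
  -- Separates the random part from the constants, using that a sample mean of zero terms is 0.
  have hsplit : ∀ (ω : Ω) (k : Fin K),
      (∑ j, w j * if N k j = 0 then μ k j else sampleMean (fun r => X k j r ω) (N k j)) =
        ∑ j, w j * sampleMean (fun r => X k j r ω) (N k j) +
          ∑ j, w j * if N k j = 0 then μ k j else 0 := by
    intro ω k
    rw [← Finset.sum_add_distrib]
    refine Finset.sum_congr rfl fun j _ => ?_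
    split_ifs with h
    · simp [h, sampleMean]
    · simp
  -- If a finite sample mean enters either design, the difference has no atoms; otherwise both
  -- values are true performances and differ by hypothesis.
  by_cases h : ∃ k j, (k = i ∨ k = i') ∧ N k j ≠ 0
  · obtain ⟨k, j, hk, hN⟩ := h
    filter_upwards [ae_sum_sampleMean_ne hX hatom hindep
      (Pi.single i 1 - Pi.single i' 1) hw N
      ((∑ j, w j * if N i' j = 0 then μ i' j else 0) - ∑ j, w j * if N i j = 0 then μ i j else 0)
      (by rcases hk with rfl | rfl <;> simp [hii, Ne.symm hii]) hN] with ω hω heq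
    refine absurd ?_ hω
    rw [hsplit, hsplit] at heq
    simp only [Pi.sub_apply, sub_mul, Finset.sum_sub_distrib, Pi.single_apply, ite_mul, one_mul,
      zero_mul, Finset.sum_ite_eq', Finset.mem_univ, if_true]
    linarith
  · push Not at h
    refine ae_of_all _ fun ω heq => hμ ?_
    simpa [h i _ (Or.inl rfl), h i' _ (Or.inr rfl)] using heq

end Outputs

/-! ### Sample paths of the procedure -/

lemma eventually_argmax_eq {ι κ : Type*} [Finite κ] {l : Filter ι} {g : ι → κ → ℝ} {v : κ → ℝ}
    (hg : ∀ i, Tendsto (fun t => g t i) l (𝓝 (v i))) {b : κ} (hb : ∀ i, v i ≤ v b)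
    (hv : Function.Injective v) {c : ι → κ} (hc : ∀ᶠ t in l, ∀ i, g t i ≤ g t (c t)) :
    ∀ᶠ t in l, c t = b := by
  have h : ∀ᶠ t in l, ∀ i, i ≠ b → g t i < g t b := by
    refine eventually_all.2 fun i => ?_
    by_cases hi : i = b
    · simp [hi]
    · filter_upwards [(hg i).eventually_lt (hg b) ((hb i).lt_of_ne (hv.ne hi))] with t ht _
      exact ht
  filter_upwards [h, hc] with t h1 h2
  by_contra hne
  exact (h1 _ hne).not_ge (h2 b)

/-- A monotone sequence of naturals stabilizes or diverges. Counts are at least `n₀ > 0`, which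
leaves the value 0 free to encode divergence. -/
lemma exists_eventually_count_eq_or_tendsto {K D : ℕ} (n₀ : ℕ) (hn₀ : n₀ ≠ 0)
    (pair : ℕ → Fin K × Fin D) (i : Fin K) (j : Fin D) :
    ∃ N : ℕ, (N ≠ 0 ∧ ∀ᶠ ℓ in atTop, count n₀ pair ℓ i j = N) ∨
      (N = 0 ∧ Tendsto (fun ℓ => count n₀ pair ℓ i j) atTop atTop) := by
  rcases tendsto_atTop_of_monotone (count_mono n₀ pair i j) with h | ⟨N, hN⟩
  · exact ⟨0, Or.inr ⟨rfl, h⟩⟩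
  · rw [nhds_discrete, tendsto_pure] at hN
    obtain ⟨ℓ, hℓ⟩ := hN.exists
    have := le_count n₀ pair ℓ i j
    exact ⟨N, Or.inl ⟨by omega, hN⟩⟩

/-- The convergence of the procedure on a sample path on which the weight estimates and the sample
means and standard deviations are consistent and the performance estimates have no ties in the
limit. -/
lemma IsRun.eventually_out_eq_and_tendsto {Ξ : Type*} {K D : ℕ} (hK : 2 ≤ K)
    {f : Fin D → Ξ → ℝ≥0} {n₀ : ℕ} (hn₀ : 2 ≤ n₀) {m n : ℕ → ℕ}
    (hn : Tendsto (cumulative n) atTop atTop)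
    {ξ : ℕ → Ξ} {x : Fin K → Fin D → ℕ → ℝ} {wHat : ℕ → Fin D → ℝ} {bHat : ℕ → Fin K}
    {aHat : ℕ → Fin K → Fin D → ℝ} {pair : ℕ → Fin K × Fin D} {out : ℕ → Fin K}
    (hrun : IsRun f n₀ m n ξ x wHat bHat aHat pair out)
    {wc : Fin D → ℝ} (hwc : ∀ j, 0 < wc j) (hw : Tendsto wHat atTop (𝓝 wc))
    {μ σ : Fin K → Fin D → ℝ} (hσ : ∀ i j, 0 < σ i j)
    (hmean : ∀ i j, Tendsto (sampleMean (x i j)) atTop (𝓝 (μ i j)))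
    (hstd : ∀ i j, Tendsto (sampleStd (x i j)) atTop (𝓝 (σ i j)))
    (hx : ∀ i j, x i j 0 ≠ x i j 1)
    (hinj : ∀ N : Fin K → Fin D → ℕ, Function.Injective fun i =>
      ∑ j, wc j * if N i j = 0 then μ i j else sampleMean (x i j) (N i j))
    {b : Fin K} (hb : ∀ i, ∑ j, wc j * μ i j ≤ ∑ j, wc j * μ b j) (j₀ : Fin D) :
    (∀ᶠ t in atTop, out t = b) ∧
      ∀ i j, Tendsto (fun ℓ => (count n₀ pair ℓ i j : ℝ) / (totalCount n₀ pair ℓ : ℝ)) atTop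
        (𝓝 (optAlloc b wc (fun i => ∑ j, wc j * μ i j) σ i j)) := by
  have : Nontrivial (Fin K) := Fin.nontrivial_iff_two_le.2 hK
  choose N hN using exists_eventually_count_eq_or_tendsto n₀ (by omega) pair
  -- Every statistic converges along the run: to its true limit if the count diverges, to its frozen
  -- value otherwise.
  have hlim : ∀ (g : (ℕ → ℝ) → ℕ → ℝ) (γ : Fin K → Fin D → ℝ),
      (∀ i j, Tendsto (g (x i j)) atTop (𝓝 (γ i j))) → ∀ i j,
      Tendsto (fun ℓ => g (x i j) (count n₀ pair ℓ i j)) atTop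
        (𝓝 (if N i j = 0 then γ i j else g (x i j) (N i j))) := by
    intro g γ hg i j
    rcases hN i j with ⟨h0, h⟩ | ⟨h0, h⟩
    · rw [if_neg h0]
      exact tendsto_const_nhds.congr' (h.mono fun ℓ hℓ => by simp only [hℓ])
    · rw [if_pos h0]
      exact (hg i j).comp h
  have hw' : ∀ j, Tendsto (fun t => wHat t j) atTop (𝓝 (wc j)) := fun j =>
    (continuous_apply j).continuousAt.tendsto.comp hw
  have hW : ∀ j, Tendsto (fun ℓ => wHat (stageOf n (ℓ + 1)) j) atTop (𝓝 (wc j)) := fun j =>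
    (hw' j).comp (tendsto_stageOf hn)
  set mLim : Fin K → ℝ := fun i =>
    ∑ j, wc j * if N i j = 0 then μ i j else sampleMean (x i j) (N i j) with hmLim
  set sLim : Fin K → Fin D → ℝ := fun i j =>
    if N i j = 0 then σ i j else sampleStd (x i j) (N i j) with hsLim
  have hm : ∀ i, Tendsto (fun ℓ =>
      estPerf x (count n₀ pair ℓ) (wHat (stageOf n (ℓ + 1))) i) atTop (𝓝 (mLim i)) := fun i =>
    tendsto_finsetSum _ fun j _ => (hW j).mul (hlim sampleMean μ hmean i j)
  have hs : ∀ i j, Tendsto (fun ℓ => estStd x (count n₀ pair ℓ) i j) atTop (𝓝 (sLim i j)) :=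
    fun i j => hlim sampleStd σ hstd i j
  have hs_pos : ∀ ℓ i j, 0 < estStd x (count n₀ pair ℓ) i j := fun ℓ i j =>
    sampleStd_pos (hx i j) (hn₀.trans (le_count n₀ pair ℓ i j))
  have hsLim_pos : ∀ i j, 0 < sLim i j := by
    intro i j
    simp only [hsLim]
    rcases hN i j with ⟨h0, h⟩ | ⟨h0, h⟩
    · rw [if_neg h0]
      obtain ⟨ℓ, hℓ⟩ := h.exists
      exact hℓ ▸ hs_pos ℓ i j
    · rw [if_pos h0]
      exact hσ i j
  have hmLim_inj : Function.Injective mLim := hinj N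
  obtain ⟨bLim, hbLim⟩ := Finite.exists_max mLim
  obtain ⟨i₀, hi₀⟩ := exists_ne bLim
  have hbHat : ∀ᶠ ℓ in atTop, bHat ℓ = bLim :=
    eventually_argmax_eq hm hbLim hmLim_inj (Eventually.of_forall hrun.best)
  have hmne : ∀ i, i ≠ bLim → mLim i ≠ mLim bLim := fun i hi => hmLim_inj.ne hi
  -- Eventually the estimated parameters are nondegenerate, so a solution exists and the target must
  -- be the explicit one.
  have haHat : ∀ᶠ ℓ in atTop,
      (∀ i j, optAlloc bLim (wHat (stageOf n (ℓ + 1)))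
        (estPerf x (count n₀ pair ℓ) (wHat (stageOf n (ℓ + 1)))) (estStd x (count n₀ pair ℓ)) i j =
          aHat ℓ i j) ∧ ∑ i, ∑ j, aHat ℓ i j = 1 := by
    have h1 : ∀ᶠ ℓ in atTop, ∀ j, 0 < wHat (stageOf n (ℓ + 1)) j :=
      eventually_all.2 fun j => (hW j).eventually_const_lt (hwc j)
    have h2 : ∀ᶠ ℓ in atTop, ∀ i, i ≠ bLim →
        estPerf x (count n₀ pair ℓ) (wHat (stageOf n (ℓ + 1))) i ≠
          estPerf x (count n₀ pair ℓ) (wHat (stageOf n (ℓ + 1))) bLim := by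
      refine eventually_all.2 fun i => ?_
      by_cases hi : i = bLim
      · simp [hi]
      · filter_upwards [((hm i).sub (hm bLim)).eventually_ne (sub_ne_zero.2 (hmne i hi))]
          with ℓ h _
        exact sub_ne_zero.1 h
    filter_upwards [h1, h2, hbHat] with ℓ e1 e2 e3
    have h3 := hrun.target ℓ
    rw [e3] at h3
    have h4 := h3 ⟨_, approxOptimal_optAlloc e1 (hs_pos ℓ) e2 hi₀ j₀⟩
    refine ⟨fun i j => ?_, h4.sum_eq_one⟩
    rw [← h4.eq_optAlloc e1 (hs_pos ℓ) e2 hi₀ j₀]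
  have hα : ∀ i j, Tendsto (fun ℓ => aHat ℓ i j) atTop (𝓝 (optAlloc bLim wc mLim sLim i j)) :=
    fun i j => (tendsto_optAlloc hwc hsLim_pos hmne hi₀ hW hm hs i j).congr'
      (haHat.mono fun ℓ h => h.1 i j)
  have hαpos := optAlloc_pos hwc hsLim_pos hmne hi₀
  have hcount := tendsto_count_div_totalCount n₀ pair hrun.choice (haHat.mono fun ℓ h => h.2) hα
    fun i j => (hαpos i j).le
  -- A frozen count would have limiting proportion 0, but the limit allocation is positive
  -- everywhere.
  have hN0 : ∀ i j, N i j = 0 ∧ Tendsto (fun ℓ => count n₀ pair ℓ i j) atTop atTop := by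
    intro i j
    rcases hN i j with ⟨h0, h⟩ | h
    · exfalso
      have h1 : Tendsto (fun ℓ => (count n₀ pair ℓ i j : ℝ) / (totalCount n₀ pair ℓ : ℝ)) atTop
          (𝓝 0) :=
        ((tendsto_totalCount n₀ pair).const_div_atTop (N i j : ℝ)).congr'
          (h.mono fun ℓ hℓ => by simp only [hℓ])
      exact (hαpos i j).ne (tendsto_nhds_unique h1 (hcount i j))
    · exact h
  have hmLim_eq : mLim = fun i => ∑ j, wc j * μ i j := by
    simp [hmLim, hN0]
  have hsLim_eq : sLim = σ := by
    simp [hsLim, hN0]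
  -- With no frozen counts the limiting performances are the true ones, so the provisional best
  -- design is `b`.
  have hb_eq : bLim = b := hmLim_inj (le_antisymm (by rw [hmLim_eq]; exact hb bLim) (hbLim b))
  rw [hmLim_eq, hsLim_eq, hb_eq] at hcount
  refine ⟨?_, hcount⟩
  refine eventually_argmax_eq
    (g := fun t => estPerf x (count n₀ pair (cumulative n t)) (wHat t))
    (v := fun i => ∑ j, wc j * μ i j) (fun i => ?_) hb (hmLim_eq ▸ hmLim_inj) ?_
  · exact tendsto_finsetSum _ fun j _ =>
      (hw' j).mul ((hmean i j).comp ((hN0 i j).2.comp hn))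
  · filter_upwards [eventually_ge_atTop 1] with t ht
    exact hrun.output t ht

end IUOCBA

/-! ### Combination of the almost sure events with the pathwise argument -/

theorem theorem2
    {Ω : Type*} [MeasurableSpace Ω] (P : Measure Ω) [IsProbabilityMeasure P]
    {Ξ : Type*} [MeasurableSpace Ξ]
    {K D : ℕ} (hK : 2 ≤ K)
    -- the input components `F j`, with densities `f j`, and the true weights
    (F : Fin D → Measure Ξ) [∀ j, IsProbabilityMeasure (F j)]
    (ν : Measure Ξ) [SigmaFinite ν] (f : Fin D → Ξ → ℝ≥0) (hf : ∀ j, Measurable (f j))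
    (hF : ∀ j, F j = ν.withDensity (fun y => (f j y : ℝ≥0∞)))
    (wc : Fin D → ℝ) (hwc_pos : ∀ j, 0 < wc j) (hwc_sum : ∑ j, wc j = 1)
    (hident : IUOCBA.Identifiable F wc)
    -- the i.i.d. input data, distributed according to the mixture
    (ξ : ℕ → Ω → Ξ) (hξ_law : ∀ s, HasLaw (ξ s) (IUOCBA.mixture F wc) P)
    (hξ_indep : iIndepFun ξ P)
    -- the random performance of the designs is Gaussian under each component
    (perf : Fin K → Kernel Ξ ℝ) [∀ i, IsMarkovKernel (perf i)]
    (μ : Fin K → Fin D → ℝ) (σ : Fin K → Fin D → ℝ≥0) (hσ : ∀ i j, 0 < σ i j)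
    (hperf : ∀ i j, (F j).bind (perf i) = gaussianReal (μ i j) (σ i j ^ 2))
    -- the independent simulation outputs
    (X : Fin K → Fin D → ℕ → Ω → ℝ)
    (hX_law : ∀ i j r, HasLaw (X i j r) ((F j).bind (perf i)) P)
    (hX_indep : iIndepFun (fun p : Fin K × Fin D × ℕ => X p.1 p.2.1 p.2.2) P)
    -- the best design; no two designs have the same expected performance
    (b : Fin K)
    (hb : ∀ i, IUOCBA.expectedPerf (perf i) (IUOCBA.mixture F wc) ≤
      IUOCBA.expectedPerf (perf b) (IUOCBA.mixture F wc))
    (hdistinct : Function.Injective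
      (fun i => IUOCBA.expectedPerf (perf i) (IUOCBA.mixture F wc)))
    -- the initial sample size, the data batch sizes and the simulation budgets
    (n₀ : ℕ) (hn₀ : 2 ≤ n₀) (m n : ℕ → ℕ)
    (hn : Tendsto (IUOCBA.cumulative n) atTop atTop)
    (hm : Tendsto (IUOCBA.cumulative m) atTop atTop)
    -- the procedure
    (wHat : ℕ → Ω → Fin D → ℝ) (bHat : ℕ → Ω → Fin K) (aHat : ℕ → Ω → Fin K → Fin D → ℝ)
    (pair : ℕ → Ω → Fin K × Fin D) (out : ℕ → Ω → Fin K)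
    (hrun : ∀ᵐ ω ∂P, IUOCBA.IsRun f n₀ m n (fun s => ξ s ω) (fun i j r => X i j r ω)
      (fun t => wHat t ω) (fun ℓ => bHat ℓ ω) (fun ℓ => aHat ℓ ω)
      (fun ℓ => pair ℓ ω) (fun t => out t ω)) :
    (∀ᵐ ω ∂P, ∀ᶠ t in atTop, out t ω = b) ∧
    ∃ αStar : Fin K → Fin D → ℝ,
      IUOCBA.ApproxOptimal b wc
        (fun i => IUOCBA.expectedPerf (perf i) (IUOCBA.mixture F wc))
        (fun i j => (σ i j : ℝ)) αStar ∧
      (∀ a, IUOCBA.ApproxOptimal b wc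
        (fun i => IUOCBA.expectedPerf (perf i) (IUOCBA.mixture F wc))
        (fun i j => (σ i j : ℝ)) a → a = αStar) ∧
      ∀ᵐ ω ∂P, ∀ i j,
        Tendsto
          (fun ℓ => (IUOCBA.count n₀ (fun k => pair k ω) ℓ i j : ℝ) /
            (IUOCBA.totalCount n₀ (fun k => pair k ω) ℓ : ℝ))
          atTop (𝓝 (αStar i j)) := by
  have hwc0 : ∀ j, 0 ≤ wc j := fun j => (hwc_pos j).le
  have hperf_eq : (fun i => IUOCBA.expectedPerf (perf i) (IUOCBA.mixture F wc)) =
      fun i => ∑ j, wc j * μ i j :=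
    funext fun i => IUOCBA.expectedPerf_mixture F (perf i) hwc0 (hperf i)
  have hb' : ∀ i, ∑ j, wc j * μ i j ≤ ∑ j, wc j * μ b j := fun i => by
    simpa only [congrFun hperf_eq] using hb i
  rw [hperf_eq] at hdistinct ⊢
  have hσ' : ∀ i j, 0 < (σ i j : ℝ) := hσ
  -- With no components the weights could not sum to one.
  obtain ⟨j₀⟩ : Nonempty (Fin D) := by
    by_contra h
    rw [not_nonempty_iff] at h
    simp at hwc_sum
  have : Nontrivial (Fin K) := Fin.nontrivial_iff_two_le.2 hK
  obtain ⟨i₀, hi₀⟩ := exists_ne b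
  have hne : ∀ i, i ≠ b → ∑ j, wc j * μ i j ≠ ∑ j, wc j * μ b j := fun i hi => hdistinct.ne hi
  have hlaw : ∀ i j r, HasLaw (X i j r) (gaussianReal (μ i j) (σ i j ^ 2)) P := fun i j r =>
    hperf i j ▸ hX_law i j r
  have hatom : ∀ i j r, NullSingletonClass (P.map (X i j r)) := fun i j r => by
    rw [(hlaw i j r).map_eq]
    exact nullSingletonClass_gaussianReal (pow_ne_zero 2 (hσ i j).ne')
  have hXm : ∀ i j r, AEMeasurable (X i j r) P := fun i j r => (hlaw i j r).aemeasurable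
  have hslln := ae_all_iff.2 fun i => ae_all_iff.2 fun j =>
    IUOCBA.ae_tendsto_sampleMean_sampleStd (hlaw i j) fun r r' hr =>
      hX_indep.indepFun (i := (i, j, r)) (j := (i, j, r')) (by simpa using hr)
  have hpath : ∀ᵐ ω ∂P, (∀ᶠ t in atTop, out t ω = b) ∧
      ∀ i j, Tendsto (fun ℓ => (IUOCBA.count n₀ (fun k => pair k ω) ℓ i j : ℝ) /
        (IUOCBA.totalCount n₀ (fun k => pair k ω) ℓ : ℝ)) atTop
        (𝓝 (IUOCBA.optAlloc b wc (fun i => ∑ j, wc j * μ i j) (fun i j => (σ i j : ℝ)) i j)) := by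
    filter_upwards [hrun, hslln,
      IUOCBA.ae_tendsto_of_isMLE hf hF hwc_pos hwc_sum hident hξ_law hξ_indep,
      ae_all_iff.2 fun i => ae_all_iff.2 fun j => IUOCBA.ae_output_ne hXm hatom hX_indep i j,
      IUOCBA.ae_perf_ne hXm hatom hX_indep hwc_pos hdistinct] with ω h1 h2 h3 h4 h5
    exact h1.eventually_out_eq_and_tendsto hK hn₀ hn hwc_pos
      (h3 _ _ hm ((eventually_ge_atTop 1).mono h1.mle)) hσ'
      (fun i j => (h2 i j).1) (fun i j => (h2 i j).2) h4 h5 hb' j₀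
  exact ⟨hpath.mono fun ω h => h.1, _,
    IUOCBA.approxOptimal_optAlloc hwc_pos hσ' hne hi₀ j₀,
    fun a ha => ha.eq_optAlloc hwc_pos hσ' hne hi₀ j₀, hpath.mono fun ω h => h.2⟩
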